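/- For positive integers $n,k,r$, an exact $r$-coloring of $[n]=\{1,\dots,n\}$ is a surjection $c:[n]\to\{1,\dots,r\}$; it is unitary if some element of $[n]$ has a color used by no other element. A $k$-term arithmetic progression $a,a+d,\dots,a+(k-1)d$ in $[n]$ with $d\ge 1$ is rainbow if its terms have pairwise distinct colors. Let $\operatorname{aw}([n],k)$ be the smallest $r\ge 1$ such that every exact $r$-coloring of $[n]$ contains a rainbow $k$-term arithmetic progression, and let $\operatorname{aw}_u([n],k)$ be the smallest $r\ge 2$ such that every exact unitary $r$-coloring of $[n]$ contains a rainbow $k$-term arithmetic progression. (If $r>n$ there is no exact $r$-coloring, and the condition holds vacuously.) Theorem. For every integer $n\ge 2$, $$\operatorname{aw}_u([n],3)=\operatorname{aw}([n],3)=\begin{cases} m+2, & \text{if } n=3^m,\\ m+3, & \text{if } n\ne 3^m \text{ and } 7\cdot 3^{m-2}+1\le n\le 21\cdot 3^{m-2},\end{cases}$$ where $m\ge 0$ is an integer, and every $n\ge 2$ falls under one of the two cases for some such $m$. Consequently, there is a constant $C$ such that $\operatorname{aw}([n],3)\le\lceil\log_3 n\rceil+C$ for all $n\ge 3$ (a conjecture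 of Butler et al.). -/

import Mathlib

/-- An `r`-coloring of `[n] = {1, …, n}`. -/
abbrev Coloring (n r : ℕ) : Type := Set.Icc 1 n → Fin r

namespace Coloring

/-- A coloring is exact if every color is used. -/
def IsExact {n r : ℕ} (c : Coloring n r) : Prop := Function.Surjective c

/-- A coloring is unitary if some element of `[n]` is uniquely colored. -/
def IsUnitary {n r : ℕ} (c : Coloring n r) : Prop :=
  ∃ x : Set.Icc 1 n, ∀ y : Set.Icc 1 n, c y = c x → y = x

/-- The coloring `c` of `[n]` contains a rainbow `k`-term arithmetic progression
`a, a + d, …, a + (k - 1) d` with `d ≥ 1`: its terms `t 0, …, t (k - 1)` all lie in `[n]`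
and have pairwise distinct colors. -/
def HasRainbowAP {n r : ℕ} (k : ℕ) (c : Coloring n r) : Prop :=
  ∃ (a d : ℕ) (t : Fin k → Set.Icc 1 n), 1 ≤ d ∧
    (∀ i : Fin k, (t i : ℕ) = a + (i : ℕ) * d) ∧
    ∀ i j : Fin k, i < j → c (t i) ≠ c (t j)

end Coloring

/-- The anti-van der Waerden number `aw([n], k)`: the smallest positive `r` such that every exact
`r`-coloring of `[n]` contains a rainbow `k`-term arithmetic progression. The set is nonempty,
since `[n]` has no exact `(n + 1)`-coloring; if `[n]` contains no `k`-term progression, the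
value is `n + 1`. -/
noncomputable def aw (n k : ℕ) : ℕ :=
  sInf {r : ℕ | 1 ≤ r ∧ ∀ c : Coloring n r, c.IsExact → c.HasRainbowAP k}

/-- The unitary anti-van der Waerden number `aw_u([n], k)`: the smallest `r ≥ 2` such that every
exact unitary `r`-coloring of `[n]` contains a rainbow `k`-term arithmetic progression. The value
`r = 1` is left out because for `n ≥ 2` no coloring with a single color is unitary, so that `r = 1`
would qualify for an empty reason. -/
noncomputable def awUnitary (n k : ℕ) : ℕ :=
  sInf {r : ℕ | 2 ≤ r ∧ ∀ c : Coloring n r, c.IsExact → c.IsUnitary → c.HasRainbowAP k}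

/-! Upper bound. In a rainbow-free coloring with `r` colors, take a shortest interval meeting all
colors (`RainbowFree.exists_interval`). Its two endpoints have colors used nowhere else in it.
Progressions through an endpoint then force the interior, measured from the left end, to be
invariant under doubling modulo the length `L`, and the progressions 2x, x + y, 2y give the sum
condition (`DoublingColoring.of_endpoints`). At least `r - 2` colors occur inside, so it remains to
bound `L` below by the number of inner colors.

The core is `DoublingColoring.exists_period`: a third color forces a proper divisor g of `L` such
that, off the multiples of g, the coloring is even and g-periodic. Hence `L = g * h`, and the colors
are shared between a coloring of length g, which is even, and one of length h
(`DoublingColoring.exists_split`). Induction gives L ≥ 3^k for k colors. The only exceptions are L =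
7·3^(k-2), coming from the coloring of {1, …, 6} by quadratic residues modulo 7
(`DoublingColoring.length_ge`). They account for the 7 in the theorem; for n = 3^m they are excluded
by one more point outside the interval (`RainbowFree.not_surj_pow`).

Lower bound. A coloring placed on one residue class modulo 3, with one new color elsewhere, stays
rainbow-free and unitary (`IsUnitaryRainbowFree.lift`). Iteration from n = 1 and from one coloring
of [8] reaches every n. All extremal colorings are unitary, so both numbers agree. -/

/-- A coloring of `{1, …, L - 1}`, `L` odd, that is invariant under doubling modulo `L` and in which
no sum `x + y < L` is rainbow together with its summands. -/
structure DoublingColoring {α : Type*} (L : ℕ) (c : ℕ → α) : Prop where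
  odd : Odd L
  double_lt : ∀ x, 0 < x → 2 * x < L → c (2 * x) = c x
  double_gt : ∀ x, x < L → L < 2 * x → c (2 * x - L) = c x
  add : ∀ x y, 0 < x → 0 < y → x + y < L → c x = c y ∨ c (x + y) = c x ∨ c (x + y) = c y

/-! ### Periods forced by a third color -/

/-- A function that is `p`-periodic outside the multiples of a divisor `d` of `p` is also
`k * p`-periodic there. -/
theorem periodic_mul_of_not_dvd {α : Type*} {φ : ℤ → α} {d p : ℤ} (hdp : d ∣ p)
    (h : ∀ t, ¬ d ∣ t → φ (t + p) = φ t) (k : ℤ) :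
    ∀ t, ¬ d ∣ t → φ (t + k * p) = φ t := by
  induction k with
  | zero => simp
  | succ k ih =>
    intro t ht
    have h1 : ¬ d ∣ t + k * p := by rwa [dvd_add_left (hdp.mul_left _)]
    rw [← ih t ht, ← h _ h1]; congr 1; ring
  | pred k ih =>
    intro t ht
    have h1 : ¬ d ∣ t + (-k - 1) * p := by rwa [dvd_add_left (hdp.mul_left _)]
    rw [← ih t ht, ← h _ h1]; congr 1; ring

/-- On `{1, …, u - 1}`, the color `C` occurs only at multiples of `g`, and outside the multiples
of `g` the coloring agrees with `φ`, which is even and `g`-periodic there. -/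
structure PeriodicBelow {α : Type*} (c : ℕ → α) (C : α) (φ : ℤ → α) (u g : ℕ) : Prop where
  one_lt : 1 < g
  dvd : ∀ x, 0 < x → x < u → c x = C → g ∣ x
  eq : ∀ x : ℕ, 0 < x → x < u → ¬ g ∣ x → c x = φ x
  periodic : ∀ t : ℤ, ¬ (g : ℤ) ∣ t → φ (t + g) = φ t
  even : ∀ t : ℤ, ¬ (g : ℤ) ∣ t → φ (-t) = φ t

namespace PeriodicBelow

variable {α : Type*} {c : ℕ → α} {φ : ℤ → α} {C : α} {u g : ℕ}

theorem exists_rep (h : PeriodicBelow c C φ u g) {t : ℤ} (ht : ¬ (g : ℤ) ∣ t) :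
    ∃ v : ℕ, 0 < v ∧ v < g ∧ (g : ℤ) ∣ t - v ∧ φ t = φ v := by
  have hg : (0 : ℤ) < g := by have := h.one_lt; omega
  have h0 := Int.emod_nonneg t hg.ne'
  have h1 := Int.emod_lt_of_pos t hg
  have h2 : t % g ≠ 0 := fun e => ht (Int.dvd_of_emod_eq_zero e)
  have h3 : t - t % g = g * (t / g) := by have := Int.emod_add_mul_ediv t g; linarith
  refine ⟨(t % g).toNat, by omega, by omega, ?_, ?_⟩
  · rw [Int.toNat_of_nonneg h0, h3]; exact dvd_mul_right _ _
  · rw [Int.toNat_of_nonneg h0]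
    rw [← periodic_mul_of_not_dvd dvd_rfl h.periodic (-(t / g)) t ht]
    congr 1; linarith

theorem congr (h : PeriodicBelow c C φ u g) {s t : ℤ} (ht : ¬ (g : ℤ) ∣ t)
    (hst : (g : ℤ) ∣ s - t) : φ s = φ t := by
  obtain ⟨k, hk⟩ := hst
  rw [← periodic_mul_of_not_dvd dvd_rfl h.periodic k t ht]
  congr 1; linarith

theorem color_eq (h : PeriodicBelow c C φ u g) {x y : ℕ} (hx : 0 < x) (hy : 0 < y) (hxu : x < u)
    (hyu : y < u) (hgx : ¬ g ∣ x) (hxy : g ∣ x + y ∨ x ≡ y [MOD g]) : c x = c y := by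
  have hgx' : ¬ (g : ℤ) ∣ (x : ℤ) := by rwa [Int.natCast_dvd_natCast]
  rcases hxy with hxy | hxy
  · have hgy : ¬ g ∣ y := fun e => hgx ((Nat.dvd_add_left e).1 hxy)
    rw [h.eq x hx hxu hgx, h.eq y hy hyu hgy, ← h.even _ hgx']
    refine (h.congr (by rwa [dvd_neg]) ?_).symm
    have : (g : ℤ) ∣ ((x + y : ℕ) : ℤ) := Int.natCast_dvd_natCast.2 hxy
    push_cast at this
    convert this using 1; ring
  · have hgy : ¬ g ∣ y := fun e => hgx ((hxy.dvd_iff dvd_rfl).2 e)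
    rw [h.eq x hx hxu hgx, h.eq y hy hyu hgy]
    exact (h.congr hgx' (Nat.modEq_iff_dvd.1 hxy)).symm

end PeriodicBelow

namespace DoublingColoring

variable {α : Type*} {c : ℕ → α} {L : ℕ}

theorem color_sub (hc : DoublingColoring L c) {x y : ℕ} (hx : 0 < x) (hxy : x < y) (hy : y < L)
    (h1 : c x ≠ c y) (h2 : c (y - x) ≠ c y) : c (y - x) = c x := by
  have := hc.add x (y - x) hx (by omega) (by omega)
  rw [Nat.add_sub_cancel' hxy.le] at this
  rcases this with h | h | h
  · exact h.symm
  · exact absurd h.symm h1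
  · exact absurd h.symm h2

/-- Below its first occurrence z a color is absent, so the sum condition for x + (z - x) = z forces
x and z - x to share a color. This is evenness modulo z. -/
theorem periodicBelow_first (hc : DoublingColoring L c) {z a : ℕ} (hzL : z < L) (ha : 0 < a)
    (haz : a < z) (hz : ∀ x, 0 < x → x < z → c x ≠ c z) :
    PeriodicBelow c (c z) (fun t => c (t % z).toNat) (z + 1) z := by
  refine ⟨by omega, ?_, ?_, ?_, ?_⟩
  · intro x hx hxz h
    rcases Nat.lt_succ_iff_lt_or_eq.1 hxz with h1 | rfl
    · exact absurd h (hz x hx h1)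
    · exact dvd_rfl
  · intro x hx hxz h
    have h1 : x < z := lt_of_le_of_ne (by omega) (by rintro rfl; exact h dvd_rfl)
    have : ((x : ℤ) % z).toNat = x := by
      rw [Int.emod_eq_of_lt (by omega) (by omega)]; simp
    simp only [this]
  · intro t _; simp
  · intro t ht
    have hz0 : (0 : ℤ) < z := by omega
    have h0 := Int.emod_nonneg t hz0.ne'
    have h1 := Int.emod_lt_of_pos t hz0
    have h2 : t % z ≠ 0 := fun e => ht (Int.dvd_of_emod_eq_zero e)
    have h3 : (-t) % z = z - t % z := by
      rw [← Int.emod_eq_of_lt (a := z - t % z) (b := z) (by omega) (by omega)]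
      apply Int.ModEq.symm
      apply Int.modEq_iff_dvd.2
      have := Int.emod_add_mul_ediv t z
      exact ⟨-(t / z) - 1, by linarith⟩
    have h4 : ((-t) % z).toNat = z - (t % z).toNat := by omega
    simp only [h4]
    exact hc.color_sub (by omega) (by omega) hzL (hz _ (by omega) (by omega))
      (hz _ (by omega) (by omega))

/-- The function `φ` never changes; only the period shrinks. If `u` has the color of `z` but is no
multiple of g, the sums v + (u - v) = u make `u` a second period, and by Bézout gcd(g, u) is a
period. The two colors occurring below `z` prevent this gcd from being 1. -/
theorem periodicBelow_step (hc : DoublingColoring L c) {φ : ℤ → α} {z a b u g : ℕ}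
    (ha : 0 < a) (haz : a < z) (hb : 0 < b) (hbz : b < z) (hab : c a ≠ c b)
    (hz : ∀ x, 0 < x → x < z → c x ≠ c z) (hzu : z < u) (huL : u < L)
    (h : PeriodicBelow c (c z) φ u g) : ∃ g', PeriodicBelow c (c z) φ (u + 1) g' := by
  have hgz : g ∣ z := h.dvd z (by omega) hzu rfl
  have hgz' : g ≤ z := Nat.le_of_dvd (by omega) hgz
  by_cases hgu : g ∣ u
  · refine ⟨g, h.one_lt, ?_, ?_, h.periodic, h.even⟩
    · intro x hx hxu hxC
      rcases Nat.lt_succ_iff_lt_or_eq.1 hxu with h1 | rfl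
      exacts [h.dvd x hx h1 hxC, hgu]
    · intro x hx hxu hgx
      rcases Nat.lt_succ_iff_lt_or_eq.1 hxu with h1 | rfl
      exacts [h.eq x hx h1 hgx, absurd hgu hgx]
  have hgu' : ¬ (g : ℤ) ∣ (u : ℤ) := by rwa [Int.natCast_dvd_natCast]
  by_cases huC : c u = c z
  swap
  · refine ⟨g, h.one_lt, ?_, ?_, h.periodic, h.even⟩
    · intro x hx hxu hxC
      rcases Nat.lt_succ_iff_lt_or_eq.1 hxu with h1 | rfl
      exacts [h.dvd x hx h1 hxC, absurd hxC huC]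
    · intro x hx hxu hgx
      rcases Nat.lt_succ_iff_lt_or_eq.1 hxu with h1 | rfl
      · exact h.eq x hx h1 hgx
      have h2 : ¬ g ∣ x - z := fun e => hgx (by
        have := Nat.dvd_add e hgz; rwa [Nat.sub_add_cancel hzu.le] at this)
      have h3 : c (x - z) ≠ c z := fun e => h2 (h.dvd _ (by omega) (by omega) e)
      have h4 := hc.add z (x - z) (by omega) (by omega) (by omega)
      rw [Nat.add_sub_cancel' hzu.le] at h4
      have h5 : c x = c (x - z) := by
        rcases h4 with h4 | h4 | h4
        exacts [absurd h4.symm h3, absurd h4 huC, h4]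
      rw [h5, h.eq _ (by omega) (by omega) h2]
      refine h.congr (by rwa [Int.natCast_dvd_natCast]) ?_
      rw [Nat.cast_sub hzu.le]
      have : (g : ℤ) ∣ (z : ℤ) := Int.natCast_dvd_natCast.2 hgz
      rw [show (x : ℤ) - z - x = -z by ring]
      exact (dvd_neg).2 this
  -- the reflection `v ↦ u - v` preserves all colors other than that of `z`
  have hrefl : ∀ v, 0 < v → v < u → c v ≠ c z → ¬ g ∣ u - v → c v = φ ((u : ℤ) - v) := by
    intro v hv hvu hvC hguv
    have h1 : c (u - v) ≠ c u := fun e =>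
      hguv (h.dvd _ (by omega) (by omega) (e.trans huC))
    rw [← hc.color_sub hv hvu huL (by rwa [huC]) h1, h.eq _ (by omega) (by omega) hguv,
      Nat.cast_sub hvu.le]
  have hshift : ∀ t : ℤ, ¬ (g : ℤ) ∣ t → ¬ (g : ℤ) ∣ t + u → φ (t + u) = φ t := by
    intro t ht htu
    obtain ⟨v, hv, hvg, hvt, hφ⟩ := h.exists_rep (t := -t) (by rwa [dvd_neg])
    have hgv : ¬ g ∣ v := Nat.not_dvd_of_pos_of_lt hv hvg
    have h1 : (g : ℤ) ∣ ((u : ℤ) - v) - (t + u) := by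
      rw [show ((u : ℤ) - v) - (t + u) = -t - v by ring]; exact hvt
    have h2 : ¬ (g : ℤ) ∣ (u : ℤ) - v := fun e => htu ((dvd_iff_dvd_of_dvd_sub h1).1 e)
    have h3 : ¬ g ∣ u - v := by
      rw [← Int.natCast_dvd_natCast, Nat.cast_sub (by omega)]; exact h2
    rw [← h.even t ht, hφ, ← h.eq v hv (by omega) hgv,
      hrefl v hv (by omega) (hz v hv (by omega)) h3]
    exact (h.congr htu h1).symm
  -- some `w < z` has a color other than `φ u`
  obtain ⟨w, hw, hwz, hwφ⟩ : ∃ w, 0 < w ∧ w < z ∧ c w ≠ φ u := by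
    by_cases e : c a = φ u
    exacts [⟨b, hb, hbz, fun e' => hab (e.trans e'.symm)⟩, ⟨a, ha, haz, e⟩]
  have hgw : ¬ g ∣ w := by
    intro e
    apply hwφ
    have h1 : ¬ g ∣ u - w := fun e' => hgu (by
      have := Nat.dvd_add e' e; rwa [Nat.sub_add_cancel (by omega)] at this)
    rw [hrefl w hw (by omega) (hz w hw hwz) h1]
    refine h.congr hgu' ?_
    rw [show (u : ℤ) - w - u = -w by ring]
    exact (dvd_neg).2 (Int.natCast_dvd_natCast.2 e)
  -- If adding `u` first hit a multiple of g at step j + 1, then w + ju ≡ -u modulo g, and evenness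
  -- would give `c w = φ u`. For g coprime to `u` the orbit would have to reach 0 modulo g.
  have horbit : ∀ j : ℕ, ¬ (g : ℤ) ∣ (w : ℤ) + j * u ∧ φ ((w : ℤ) + j * u) = c w := by
    intro j
    induction j with
    | zero => simpa [Int.natCast_dvd_natCast, hgw] using (h.eq w hw (by omega) hgw).symm
    | succ j ih =>
      have e1 : (w : ℤ) + (j + 1 : ℕ) * u = (w + j * u) + u := by push_cast; ring
      have h1 : ¬ (g : ℤ) ∣ (w : ℤ) + (j + 1 : ℕ) * u := by
        rw [e1]
        intro e
        apply hwφ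
        rw [← ih.2, ← h.even _ hgu']
        exact h.congr (by rwa [dvd_neg]) (by rwa [sub_neg_eq_add])
      exact ⟨h1, by rw [e1, hshift _ ih.1 (by rwa [← e1]), ih.2]⟩
  have hdg : ((g.gcd u : ℕ) : ℤ) ∣ g := Int.natCast_dvd_natCast.2 (Nat.gcd_dvd_left g u)
  have hdu : ((g.gcd u : ℕ) : ℤ) ∣ u := Int.natCast_dvd_natCast.2 (Nat.gcd_dvd_right g u)
  have hd1 : g.gcd u ≠ 1 := by
    intro e
    have hcop : Nat.Coprime g u := e
    have : NeZero g := ⟨by have := h.one_lt; omega⟩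
    have hunit : IsUnit (u : ZMod g) := (ZMod.isUnit_iff_coprime u g).2 hcop.symm
    obtain ⟨v, hv⟩ := hunit.exists_left_inv
    apply (horbit (-(w : ZMod g) * v).val).1
    rw [← ZMod.intCast_zmod_eq_zero_iff_dvd]
    push_cast
    rw [ZMod.natCast_zmod_val, mul_assoc, hv]
    ring
  have hd0 : 0 < g.gcd u := Nat.gcd_pos_of_pos_left _ (by have := h.one_lt; omega)
  refine ⟨g.gcd u, by omega, ?_, ?_, ?_, ?_⟩
  · intro x hx hxu hxC
    rcases Nat.lt_succ_iff_lt_or_eq.1 hxu with h1 | rfl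
    exacts [(Nat.gcd_dvd_left g u).trans (h.dvd x hx h1 hxC), Nat.gcd_dvd_right _ _]
  · intro x hx hxu hgx
    rcases Nat.lt_succ_iff_lt_or_eq.1 hxu with h1 | rfl
    exacts [h.eq x hx h1 fun e => hgx ((Nat.gcd_dvd_left g u).trans e),
      absurd (Nat.gcd_dvd_right _ _) hgx]
  · intro t ht
    have h1 := periodic_mul_of_not_dvd hdg (fun t ht => h.periodic t fun e => ht (hdg.trans e))
    have h2 := periodic_mul_of_not_dvd hdu (φ := φ) fun t ht =>
      hshift t (fun e => ht (hdg.trans e)) fun e => ht ((dvd_add_left hdu).1 (hdg.trans e))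
    rw [← h1 (g.gcdA u) t ht,
      ← h2 (g.gcdB u) (t + g.gcdA u * g) (by rwa [dvd_add_left (hdg.mul_left _)]),
      Nat.gcd_eq_gcd_ab]
    congr 1; ring
  · exact fun t ht => h.even t fun e => ht (hdg.trans e)

/-- If a third color first occurs at `z`, the coloring is even and periodic, with a period that is
a proper divisor of `L`, outside the multiples of this period. -/
theorem exists_period (hc : DoublingColoring L c) {z a b : ℕ}
    (ha : 0 < a) (haz : a < z) (hb : 0 < b) (hbz : b < z) (hab : c a ≠ c b)
    (hz : ∀ x, 0 < x → x < z → c x ≠ c z) (hzL : z < L) :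
    ∃ g, 1 < g ∧ g < L ∧ g ∣ L ∧ ∀ x y, 0 < x → 0 < y → x < L → y < L → ¬ g ∣ x →
      (g ∣ x + y ∨ x ≡ y [MOD g]) → c x = c y := by
  obtain ⟨φ, hφ⟩ : ∃ φ : ℤ → α, ∀ u, z < u → u ≤ L → ∃ g, PeriodicBelow c (c z) φ u g := by
    refine ⟨fun t => c (t % z).toNat, fun u hu => ?_⟩
    induction u, hu using Nat.le_induction with
    | base => exact fun _ => ⟨z, hc.periodicBelow_first hzL ha haz hz⟩
    | succ u hu ih =>
      intro huL
      obtain ⟨g, hg⟩ := ih (by omega)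
      exact hc.periodicBelow_step ha haz hb hbz hab hz hu (by omega) hg
  obtain ⟨g, hg⟩ := hφ L hzL le_rfl
  have hgz := hg.dvd z (by omega) hzL rfl
  refine ⟨g, hg.one_lt, (Nat.le_of_dvd (by omega) hgz).trans_lt hzL, ?_,
    fun x y hx hy hxL hyL hgx hxy => hg.color_eq hx hy hxL hyL hgx hxy⟩
  by_contra hgL
  -- Doubling `z` keeps its color. The first time it passes `L`, the reduced value has that color
  -- too and so is a multiple of g, which makes g divide `L`. Otherwise the powers of two stay below
  -- `L` forever.
  have key : ∀ i : ℕ, 2 ^ i * z < L ∧ c (2 ^ i * z) = c z := by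
    intro i
    induction i with
    | zero => simpa using hzL
    | succ i ih =>
      have hpos : 0 < 2 ^ i * z := Nat.mul_pos (by positivity) (by omega)
      obtain ⟨k, hk⟩ := hc.odd
      rcases lt_or_gt_of_ne (show 2 * (2 ^ i * z) ≠ L by omega) with h1 | h1
      · rw [pow_succ', mul_assoc]
        exact ⟨h1, (hc.double_lt _ hpos h1).trans ih.2⟩
      · refine absurd ?_ hgL
        have h2 := hg.dvd _ (by omega) (by omega) ((hc.double_gt _ ih.1 h1).trans ih.2)
        have h3 : g ∣ 2 * (2 ^ i * z) := (hgz.mul_left _).mul_left _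
        exact (Nat.dvd_sub_iff_right h1.le h3).1 h2
  have h1 := (key L).1
  have h2 : L < 2 ^ L := Nat.lt_two_pow_self
  nlinarith
end DoublingColoring

/-! ### Length against number of colors -/

namespace DoublingColoring

variable {α : Type*} {c : ℕ → α} {L : ℕ}

/-- As `L` is odd, the cofactor of g is at least 3, so 2x < 2g < L for x < g. Doubling modulo g is
thus doubling modulo `L` followed by a shift by the period. -/
theorem restrict_period (hc : DoublingColoring L c) {g : ℕ} (hg : 1 < g) (hgL : g < L)
    (hgd : g ∣ L) (hper : ∀ x y, 0 < x → 0 < y → x < L → y < L → ¬ g ∣ x →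
      (g ∣ x + y ∨ x ≡ y [MOD g]) → c x = c y) : DoublingColoring g c := by
  have h2 : 2 * g < L := by
    obtain ⟨h, rfl⟩ := hgd
    obtain ⟨k, hk⟩ := hc.odd
    have h1 : 1 < h := by by_contra! h1; interval_cases h <;> omega
    have h3 : h ≠ 2 := by rintro rfl; omega
    nlinarith [show 3 ≤ h by omega]
  refine ⟨Odd.of_dvd_nat hc.odd hgd, fun x hx hxg => hc.double_lt x hx (by omega), ?_,
    fun x y hx hy hxy => hc.add x y hx hy (by omega)⟩
  intro x hx hgx
  rw [← hc.double_lt x (by omega) (by omega)]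
  refine hper _ _ (by omega) (by omega) (by omega) (by omega)
    (Nat.not_dvd_of_pos_of_lt (by omega) (by omega)) (Or.inr ?_)
  exact (Nat.modEq_iff_dvd' (by omega)).2 ⟨1, by omega⟩

theorem comp_mul (g : ℕ) {h : ℕ} (hg : 0 < g) (hc : DoublingColoring (g * h) c) :
    DoublingColoring h (fun i => c (g * i)) := by
  refine ⟨Odd.of_dvd_nat hc.odd (dvd_mul_left _ _), ?_, ?_, ?_⟩
  · intro x hx hxh
    have := hc.double_lt (g * x) (by positivity) (by nlinarith)
    rwa [mul_left_comm] at this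
  · intro x hx hxh
    have := hc.double_gt (g * x) (by nlinarith) (by nlinarith)
    rwa [mul_left_comm, ← Nat.mul_sub] at this
  · intro x y hx hy hxy
    have := hc.add (g * x) (g * y) (by positivity) (by positivity) (by nlinarith)
    rwa [← mul_add] at this

theorem seven_eq (hc : DoublingColoring 7 c) :
    c 2 = c 1 ∧ c 4 = c 1 ∧ c 5 = c 3 ∧ c 6 = c 3 := by
  have h2 := hc.double_lt 1 (by norm_num) (by norm_num)
  have h4 := hc.double_lt 2 (by norm_num) (by norm_num)
  have h3 := hc.double_lt 3 (by norm_num) (by norm_num)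
  have h5 := hc.double_gt 5 (by norm_num) (by norm_num)
  norm_num at h2 h3 h4 h5
  exact ⟨h2, h4.trans h2, h5.symm, h3⟩

/-- At the multiples of `q`, the coloring is the exceptional two-coloring of `{1, …, 6}`. -/
structure IsSpecial (c : ℕ → α) (q : ℕ) : Prop where
  two : c (2 * q) = c q
  four : c (4 * q) = c q
  five : c (5 * q) = c (3 * q)
  six : c (6 * q) = c (3 * q)
  ne : c q ≠ c (3 * q)

variable [DecidableEq α]

/-- The set of colors of `1, …, L - 1`. -/
def colors (L : ℕ) (c : ℕ → α) : Finset α := (Finset.Ioo 0 L).image c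

theorem mem_colors {x : α} : x ∈ colors L c ↔ ∃ i, 0 < i ∧ i < L ∧ c i = x := by
  simp [colors, and_assoc]

/-- A coloring with at least three colors splits along a proper divisor of `L`. -/
theorem exists_split (hc : DoublingColoring L c) (h3 : 3 ≤ (colors L c).card) :
    ∃ g h, 1 < g ∧ 1 < h ∧ L = g * h ∧ DoublingColoring g c ∧
      DoublingColoring h (fun i => c (g * i)) ∧ (∀ x, 0 < x → x < g → c (g - x) = c x) ∧
      (colors L c).card ≤ (colors g c).card + (colors h (fun i => c (g * i))).card := by
  classical
  have h1 : ∃ b, 0 < b ∧ b < L ∧ c b ≠ c 1 := by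
    by_contra! hcon
    have : colors L c ⊆ {c 1} := by
      intro x hx
      obtain ⟨i, hi, hiL, rfl⟩ := mem_colors.1 hx
      simp [hcon i hi hiL]
    have := Finset.card_le_card this
    simp at this; omega
  obtain ⟨hb, hbL, hb1⟩ := Nat.find_spec h1
  have hbmin := fun m hm => Nat.find_min h1 (m := m) hm
  set b := Nat.find h1
  have h2 : ∃ z, 0 < z ∧ z < L ∧ c z ≠ c 1 ∧ c z ≠ c b := by
    by_contra! hcon
    have : colors L c ⊆ {c 1, c b} := by
      intro x hx
      obtain ⟨i, hi, hiL, rfl⟩ := mem_colors.1 hx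
      have := hcon i hi hiL
      simp; tauto
    have := (Finset.card_le_card this).trans Finset.card_le_two
    omega
  obtain ⟨hz, hzL, hz1, hzb⟩ := Nat.find_spec h2
  have hzmin := fun m hm => Nat.find_min h2 (m := m) hm
  set z := Nat.find h2
  have hbz : b < z := by
    by_contra! hle
    rcases hle.lt_or_eq with h | h
    · exact hbmin z h ⟨hz, hzL, hz1⟩
    · exact hzb (by rw [h])
  have h1z : 1 < z := by
    rcases Nat.lt_or_ge 1 z with h | h
    · exact h
    · omega
  obtain ⟨g, hg, hgL, ⟨h, hgd⟩, hper⟩ := hc.exists_period one_pos h1z hb hbz hb1.symm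
    (fun x hx hxz e => hzmin x hxz ⟨hx, by omega, by rwa [e], by rwa [e]⟩) hzL
  have hh : 1 < h := by
    by_contra! hcon
    have : g * h ≤ g * 1 := Nat.mul_le_mul_left g hcon
    omega
  refine ⟨g, h, hg, hh, hgd, hc.restrict_period hg hgL ⟨h, hgd⟩ hper,
    comp_mul g (by omega) (by rwa [← hgd]), ?_, ?_⟩
  · intro x hx hxg
    exact hper _ _ (by omega) hx (by omega) (by omega)
      (Nat.not_dvd_of_pos_of_lt (by omega) (by omega)) (Or.inl ⟨1, by omega⟩)
  -- Off the multiples of g, each color already occurs at the residue modulo g.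
  · refine le_trans (Finset.card_le_card ?_) (Finset.card_union_le _ _)
    intro x hx
    obtain ⟨i, hi, hiL, rfl⟩ := mem_colors.1 hx
    rw [Finset.mem_union, mem_colors, mem_colors]
    by_cases hgi : g ∣ i
    · obtain ⟨j, rfl⟩ := hgi
      refine Or.inr ⟨j, Nat.pos_of_mul_pos_left hi, ?_, rfl⟩
      rw [hgd] at hiL
      exact lt_of_mul_lt_mul_left hiL (Nat.zero_le _)
    · have h0 : 0 < i % g := Nat.pos_of_ne_zero fun e => hgi (Nat.dvd_of_mod_eq_zero e)
      have h4 := Nat.mod_lt i (show 0 < g by omega)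
      exact Or.inl ⟨i % g, h0, h4,
        (hper i (i % g) hi h0 hiL (by omega) hgi (Or.inr (Nat.mod_modEq i g).symm)).symm⟩

theorem card_colors_le_of_subset {s : Finset α} {k : ℕ} (hs : s.card ≤ k)
    (h : ∀ i, 0 < i → i < L → c i ∈ s) : (colors L c).card ≤ k := by
  refine (Finset.card_le_card fun x hx => ?_).trans hs
  obtain ⟨i, hi, hiL, rfl⟩ := mem_colors.1 hx
  exact h i hi hiL

theorem colors_three (hc : DoublingColoring 3 c) : (colors 3 c).card ≤ 1 := by
  have h2 := hc.double_lt 1 (by norm_num) (by norm_num)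
  norm_num at h2
  refine card_colors_le_of_subset (s := {c 1}) (by simp) fun i hi hi' => ?_
  interval_cases i <;> simp [h2]

theorem colors_five (hc : DoublingColoring 5 c) : (colors 5 c).card ≤ 1 := by
  have h2 := hc.double_lt 1 (by norm_num) (by norm_num)
  have h4 := hc.double_lt 2 (by norm_num) (by norm_num)
  have h3 := hc.double_gt 3 (by norm_num) (by norm_num)
  norm_num at h2 h3 h4
  refine card_colors_le_of_subset (s := {c 1}) (by simp) fun i hi hi' => ?_
  interval_cases i <;> simp [h2, h4, ← h3]

theorem colors_eleven (hc : DoublingColoring 11 c) : (colors 11 c).card ≤ 1 := by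
  have h2 := hc.double_lt 1 (by norm_num) (by norm_num)
  have h4 := hc.double_lt 2 (by norm_num) (by norm_num)
  have h6 := hc.double_lt 3 (by norm_num) (by norm_num)
  have h8 := hc.double_lt 4 (by norm_num) (by norm_num)
  have h10 := hc.double_lt 5 (by norm_num) (by norm_num)
  have h5 := hc.double_gt 8 (by norm_num) (by norm_num)
  have h9 := hc.double_gt 10 (by norm_num) (by norm_num)
  have h7 := hc.double_gt 9 (by norm_num) (by norm_num)
  have h3 := hc.double_gt 7 (by norm_num) (by norm_num)
  norm_num at h2 h4 h6 h8 h10 h5 h9 h7 h3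
  refine card_colors_le_of_subset (s := {c 1}) (by simp) fun i hi hi' => ?_
  interval_cases i <;> simp <;> grind

theorem colors_one : (colors 1 c).card = 0 := by
  simp [colors, show Finset.Ioo 0 1 = ∅ from rfl]

/-- Evenness rules out two colors at length 7. The surplus factor 9/7 is exactly what `length_ge`
needs to compensate an exceptional second factor, whose length 7·3^j falls short of 3^(j+2) by 7/9.
-/
theorem length_of_even (hc : DoublingColoring L c) (heven : ∀ x, 0 < x → x < L → c (L - x) = c x) :
    L = 3 ^ (colors L c).card ∨ 9 * 3 ^ (colors L c).card ≤ 7 * L := by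
  induction L using Nat.strong_induction_on generalizing c with
  | _ L ih =>
  rcases Nat.lt_or_ge (colors L c).card 3 with h3 | h3
  · obtain ⟨k, hk⟩ := hc.odd
    -- With at most two colors the inequality 9·3^2 ≤ 7L suffices, and it fails only for L < 12.
    rcases Nat.lt_or_ge L 13 with hL | hL
    · have hL' : L = 1 ∨ L = 3 ∨ L = 5 ∨ L = 7 ∨ L = 9 ∨ L = 11 := by omega
      rcases hL' with rfl | rfl | rfl | rfl | rfl | rfl
      · left; simp [colors_one]
      · have := colors_three hc
        interval_cases (colors 3 c).card <;> simp
      · have := colors_five hc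
        interval_cases (colors 5 c).card <;> simp
      · obtain ⟨h2, h4, h5, h6⟩ := hc.seven_eq
        have h1 := heven 1 (by norm_num) (by norm_num)
        norm_num at h1
        have : (colors 7 c).card ≤ 1 := by
          refine card_colors_le_of_subset (s := {c 1}) (by simp) fun i hi hi' => ?_
          interval_cases i <;> simp <;> grind
        interval_cases (colors 7 c).card <;> simp
      · interval_cases (colors 9 c).card <;> simp
      · have := colors_eleven hc
        interval_cases (colors 11 c).card <;> simp
    · right
      interval_cases (colors L c).card <;> omega
  · obtain ⟨g, h, hg, hh, rfl, hcg, hch, hsym, hcard⟩ := hc.exists_split h3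
    have ihg := ih g (by nlinarith) hcg hsym
    have ihh := ih h (by nlinarith) hch fun x hx hxh => by
      have := heven (g * x) (by positivity) (by nlinarith)
      rwa [← Nat.mul_sub] at this
    set k := (colors (g * h) c).card
    set k₁ := (colors g c).card
    set k₂ := (colors h fun i => c (g * i)).card
    have hk : 3 ^ k ≤ 3 ^ k₁ * 3 ^ k₂ := by
      rw [← pow_add]; exact Nat.pow_le_pow_right (by norm_num) hcard
    rcases ihg with ihg | ihg <;> rcases ihh with ihh | ihh
    · rcases hcard.lt_or_eq with h1 | h1
      · right
        have : 3 ^ (k + 1) ≤ 3 ^ (k₁ + k₂) := Nat.pow_le_pow_right (by norm_num) h1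
        rw [ihg, ihh, ← pow_add]
        rw [pow_succ] at this
        omega
      · left; rw [ihg, ihh, ← pow_add, h1]
    · right; rw [← ihg] at hk; nlinarith
    · right; rw [← ihh] at hk; nlinarith
    · right
      have h1 : 3 ^ k₂ ≤ h := by omega
      have h2 := Nat.mul_le_mul ihg h1
      nlinarith

/-- After a split, the factor g is even, so it has length exactly 3^k₁ or a surplus of 9/7. An
exceptional factor h therefore leaves the product exceptional only if g = 3^k₁ and no color is lost;
a lost color gains a factor 3. -/
theorem length_ge (hc : DoublingColoring L c) :
    3 ^ (colors L c).card ≤ L ∨ ∃ j, (colors L c).card = j + 2 ∧ L = 7 * 3 ^ j ∧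
      IsSpecial c (3 ^ j) := by
  induction L using Nat.strong_induction_on generalizing c with
  | _ L ih =>
  rcases Nat.lt_or_ge (colors L c).card 3 with h3 | h3
  · obtain ⟨k, hk⟩ := hc.odd
    rcases Nat.lt_or_ge L 9 with hL | hL
    · have hL' : L = 1 ∨ L = 3 ∨ L = 5 ∨ L = 7 := by omega
      rcases hL' with rfl | rfl | rfl | rfl
      · left; simp [colors_one]
      · have := colors_three hc
        left
        interval_cases (colors 3 c).card <;> simp
      · have := colors_five hc
        left
        interval_cases (colors 5 c).card <;> simp
      · obtain ⟨h2, h4, h5, h6⟩ := hc.seven_eq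
        by_cases h1 : c 1 = c 3
        · have : (colors 7 c).card ≤ 1 := by
            refine card_colors_le_of_subset (s := {c 1}) (by simp) fun i hi hi' => ?_
            interval_cases i <;> simp <;> grind
          left
          interval_cases (colors 7 c).card <;> simp
        · rcases Nat.lt_or_ge (colors 7 c).card 2 with h | h
          · left
            interval_cases (colors 7 c).card <;> simp
          · exact Or.inr ⟨0, by omega, by norm_num, by constructor <;> simpa⟩
    · left
      interval_cases (colors L c).card <;> omega
  · obtain ⟨g, h, hg, hh, rfl, hcg, hch, hsym, hcard⟩ := hc.exists_split h3
    have ihg := hcg.length_of_even hsym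
    have ihh := ih h (by nlinarith) hch
    set k := (colors (g * h) c).card
    set k₁ := (colors g c).card
    set k₂ := (colors h fun i => c (g * i)).card
    have hk : 3 ^ k ≤ 3 ^ k₁ * 3 ^ k₂ := by
      rw [← pow_add]; exact Nat.pow_le_pow_right (by norm_num) hcard
    have hg1 : 3 ^ k₁ ≤ g := by omega
    rcases ihh with ihh | ⟨j, hj, hj7, hsp⟩
    · left; exact hk.trans (Nat.mul_le_mul hg1 ihh)
    rw [hj, pow_add] at hk
    rcases ihg with ihg | ihg
    · rcases hcard.lt_or_eq with h1 | h1
      · left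
        have : 3 ^ (k + 1) ≤ 3 ^ (k₁ + k₂) := Nat.pow_le_pow_right (by norm_num) h1
        rw [pow_succ, pow_add, hj, pow_add] at this
        rw [ihg, hj7]
        nlinarith
      · right
        refine ⟨k₁ + j, by omega, ?_, ?_⟩
        · rw [ihg, hj7, pow_add]; ring
        · rw [pow_add, ← ihg]
          obtain ⟨s2, s4, s5, s6, sne⟩ := hsp
          constructor <;> simpa only [mul_left_comm _ g] 
    · left
      rw [hj7]
      have := Nat.mul_le_mul_right (3 ^ j) ihg
      nlinarith

end DoublingColoring

/-! ### Rainbow-free colorings and the upper bound -/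

/-- Among the integers `1, …, n`, the coloring `f` has no rainbow `3`-term progression. -/
def RainbowFree (n : ℕ) (f : ℕ → ℕ) : Prop :=
  ∀ a d, 0 < a → 0 < d → a + 2 * d ≤ n →
    f a = f (a + d) ∨ f (a + d) = f (a + 2 * d) ∨ f a = f (a + 2 * d)

/-- A rainbow-free coloring of `{0, …, L}` with uniquely colored endpoints is a doubling coloring. -/
theorem DoublingColoring.of_endpoints {e : ℕ → ℕ} {L : ℕ} (hL : 0 < L)
    (hR : ∀ a d, 0 < d → a + 2 * d ≤ L →
      e a = e (a + d) ∨ e (a + d) = e (a + 2 * d) ∨ e a = e (a + 2 * d))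
    (h0 : ∀ x, 0 < x → x ≤ L → e x ≠ e 0) (h1 : ∀ x, x < L → e x ≠ e L) :
    DoublingColoring L e := by
  have hodd : Odd L := by
    by_contra hcon
    obtain ⟨k, hk⟩ := Nat.not_odd_iff_even.1 hcon
    have hkL : 0 + 2 * k = L := by omega
    rcases hR 0 k (by omega) (by omega) with h | h | h
    · rw [zero_add] at h
      exact h0 k (by omega) (by omega) h.symm
    · rw [hkL, zero_add] at h
      exact h1 k (by omega) h
    · rw [hkL] at h
      exact h0 L hL le_rfl h.symm
  have hlt : ∀ x, 0 < x → 2 * x < L → e (2 * x) = e x := by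
    intro x hx hxL
    have := hR 0 x hx (by omega)
    rw [zero_add, zero_add] at this
    rcases this with h | h | h
    · exact absurd h.symm (h0 x hx (by omega))
    · exact h.symm
    · exact absurd h.symm (h0 _ (by omega) (by omega))
  have hgt : ∀ x, x < L → L < 2 * x → e (2 * x - L) = e x := by
    intro x hx hxL
    have := hR (2 * x - L) (L - x) (by omega) (by omega)
    rw [show 2 * x - L + (L - x) = x by omega, show 2 * x - L + 2 * (L - x) = L by omega] at this
    rcases this with h | h | h
    · exact h
    · exact absurd h (h1 x hx)
    · exact absurd h (h1 _ (by omega))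
  refine ⟨hodd, hlt, hgt, ?_⟩
  -- For 2y < L the progression 2x, x + y, 2y has the colors of x, x + y, y. For 2y > L, doubling
  -- modulo `L` replaces x, y by 2x, 2y - L with the same colors, and the sum drops because x + y <
  -- L.
  have key : ∀ N x y, x + y ≤ N → 0 < x → 0 < y → x ≤ y → x + y < L →
      e x = e y ∨ e (x + y) = e x ∨ e (x + y) = e y := by
    intro N
    induction N with
    | zero => intros; omega
    | succ N ih =>
      intro x y hN hx hy hle hxy
      have hx2 := hlt x hx (by omega)
      obtain ⟨k, hk⟩ := hodd
      rcases lt_or_gt_of_ne (show 2 * y ≠ L by omega) with hyL | hyL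
      · rcases hle.eq_or_lt with rfl | hlt'
        · exact Or.inl rfl
        have := hR (2 * x) (y - x) (by omega) (by omega)
        rw [show 2 * x + (y - x) = x + y by omega, show 2 * x + 2 * (y - x) = 2 * y by omega,
          hx2, hlt y hy hyL] at this
        tauto
      · have hy2 := hgt y (by omega) hyL
        have hs := hgt (x + y) hxy (by omega)
        rw [show 2 * (x + y) - L = 2 * x + (2 * y - L) by omega] at hs
        rw [← hx2, ← hy2, ← hs]
        rcases Nat.le_total (2 * x) (2 * y - L) with h | h
        · exact ih _ _ (by omega) (by omega) (by omega) h (by omega)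
        · have := ih _ _ (by omega) (by omega) (by omega) h (by omega)
          rw [add_comm (2 * y - L)] at this
          tauto
  intro x y hx hy hxy
  rcases Nat.le_total x y with h | h
  · exact key _ x y le_rfl hx hy h hxy
  · have := key _ y x le_rfl hy hx h (by omega)
    rw [add_comm y] at this
    tauto

/-- A shortest interval that meets all `r` colors is a doubling coloring with at least `r - 2`
inner colors. -/
theorem RainbowFree.exists_interval {n r : ℕ} {f : ℕ → ℕ} (hf : RainbowFree n f) (hr : 2 ≤ r)
    (hsurj : ∀ i < r, ∃ x, 0 < x ∧ x ≤ n ∧ f x = i) :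
    ∃ s L, 0 < s ∧ 0 < L ∧ s + L ≤ n ∧ DoublingColoring L (fun i => f (s + i)) ∧
      (∀ x, 0 < x → x ≤ L → f (s + x) ≠ f s) ∧ (∀ x, x < L → f (s + x) ≠ f (s + L)) ∧
      r ≤ (DoublingColoring.colors L (fun i => f (s + i))).card + 2 := by
  classical
  have hex : ∃ L s, 0 < s ∧ s + L ≤ n ∧ ∀ i < r, ∃ x ≤ L, f (s + x) = i := by
    refine ⟨n - 1, 1, one_pos, ?_, ?_⟩
    · obtain ⟨x, hx, hxn, -⟩ := hsurj 0 (by omega)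
      omega
    · intro i hi
      obtain ⟨x, hx, hxn, rfl⟩ := hsurj i hi
      exact ⟨x - 1, by omega, by congr 1; omega⟩
  obtain ⟨s, hs, hsn, hcol⟩ := Nat.find_spec hex
  have hmin := fun m hm => Nat.find_min hex (m := m) hm
  set L := Nat.find hex
  have hL : 0 < L := by
    by_contra! hcon
    obtain ⟨x, hx, hx0⟩ := hcol 0 (by omega)
    obtain ⟨y, hy, hy1⟩ := hcol 1 (by omega)
    rw [show x = y by omega] at hx0
    omega
  have h0 : ∀ x, 0 < x → x ≤ L → f (s + x) ≠ f s := by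
    intro x hx hxL hfx
    refine hmin (L - 1) (by omega) ⟨s + 1, by omega, by omega, fun i hi => ?_⟩
    obtain ⟨y, hy, rfl⟩ := hcol i hi
    rcases Nat.eq_zero_or_pos y with rfl | hy0
    · exact ⟨x - 1, by omega, by rw [add_zero, ← hfx]; congr 1; omega⟩
    · exact ⟨y - 1, by omega, by congr 1; omega⟩
  have h1 : ∀ x, x < L → f (s + x) ≠ f (s + L) := by
    intro x hxL hfx
    refine hmin (L - 1) (by omega) ⟨s, hs, by omega, fun i hi => ?_⟩
    obtain ⟨y, hy, rfl⟩ := hcol i hi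
    rcases hy.lt_or_eq with h | rfl
    · exact ⟨y, by omega, rfl⟩
    · exact ⟨x, by omega, hfx⟩
  refine ⟨s, L, hs, hL, hsn, DoublingColoring.of_endpoints hL ?_ h0 h1, h0, h1, ?_⟩
  · intro a d hd had
    have := hf (s + a) d (by omega) hd (by omega)
    rwa [add_assoc, add_assoc] at this
  · have hsub : Finset.range r ⊆
        DoublingColoring.colors L (fun i => f (s + i)) ∪ {f s, f (s + L)} := by
      intro i hi
      obtain ⟨y, hy, rfl⟩ := hcol i (Finset.mem_range.1 hi)
      rw [Finset.mem_union, DoublingColoring.mem_colors]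
      rcases Nat.eq_zero_or_pos y with rfl | hy0
      · right; simp
      · rcases hy.lt_or_eq with h | rfl
        · exact Or.inl ⟨y, hy0, h, rfl⟩
        · right; simp
    have := (Finset.card_le_card hsub).trans (Finset.card_union_le _ _)
    rw [Finset.card_range] at this
    exact this.trans (Nat.add_le_add_left Finset.card_le_two _)

/-- At least m + 1 inner colors force L ≥ 3^(m+1) or L ≥ 7·3^(m-1) ≥ n, whereas L < n because the
interval starts at a positive integer. -/
theorem RainbowFree.not_surj_of_le {n m : ℕ} {f : ℕ → ℕ} (hf : RainbowFree n f)
    (hn : 9 * n ≤ 21 * 3 ^ m) : ¬ ∀ i < m + 3, ∃ x, 0 < x ∧ x ≤ n ∧ f x = i := by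
  intro hsurj
  obtain ⟨s, L, hs, hL, hsn, hc, -, -, hr⟩ := hf.exists_interval (by omega) hsurj
  rcases hc.length_ge with h | ⟨j, hj, hj7, -⟩
  · have := (Nat.pow_le_pow_right (by norm_num) (show m + 1 ≤ _ by omega)).trans h
    rw [pow_succ] at this
    omega
  · have : 3 ^ m ≤ 3 ^ (j + 1) := Nat.pow_le_pow_right (by norm_num) (by omega)
    rw [pow_succ] at this
    omega

/-- Only the exceptional length 7q in [9q] survives the count. Then s - q or s + 8q also lies in
[9q], and no color is possible there. -/
theorem RainbowFree.not_surj_pow {m : ℕ} {f : ℕ → ℕ} (hf : RainbowFree (3 ^ m) f) :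
    ¬ ∀ i < m + 2, ∃ x, 0 < x ∧ x ≤ 3 ^ m ∧ f x = i := by
  intro hsurj
  obtain ⟨s, L, hs, hL, hsn, hc, h0, h1, hr⟩ := hf.exists_interval (by omega) hsurj
  rcases hc.length_ge with h | ⟨j, hj, hj7, hsp⟩
  · have := (Nat.pow_le_pow_right (n := 3) (by norm_num) (show m ≤ _ by omega)).trans h
    omega
  have hjm : j + 2 = m := by
    by_contra hne
    have : 3 ^ m ≤ 3 ^ (j + 1) := Nat.pow_le_pow_right (by norm_num) (by omega)
    rw [pow_succ] at this
    omega
  have hm9 : 3 ^ m = 9 * 3 ^ j := by rw [← hjm, pow_add]; ring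
  rw [hm9] at hsn hf
  have hq : 0 < 3 ^ j := by positivity
  obtain ⟨s2, s4, s5, s6, sne⟩ := hsp
  set q := 3 ^ j
  subst hj7
  have a1 := h0 q (by omega) (by omega)
  have a3 := h0 (3 * q) (by omega) (by omega)
  have a7 := h0 (7 * q) (by omega) (by omega)
  have b1 := h1 q (by omega)
  have b3 := h1 (3 * q) (by omega)
  -- The colors at s, s + q, s + 3q, s + 7q are distinct. At the extra point, one progression
  -- permits only the colors of s and s + q, the other only those of s + 3q and s + 7q.
  rcases Nat.lt_or_ge q s with hsq | hsq
  · have e1 := hf (s - q) q (by omega) hq (by omega)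
    have e2 := hf (s - q) (4 * q) (by omega) (by omega) (by omega)
    rw [show s - q + q = s by omega, show s - q + 2 * q = s + q by omega] at e1
    rw [show s - q + 4 * q = s + 3 * q by omega,
      show s - q + 2 * (4 * q) = s + 7 * q by omega] at e2
    grind
  · have e1 := hf (s + 6 * q) q (by omega) hq (by omega)
    have e2 := hf s (4 * q) (by omega) (by omega) (by omega)
    rw [show s + 6 * q + q = s + 7 * q by omega,
      show s + 6 * q + 2 * q = s + 8 * q by omega] at e1
    rw [show s + 2 * (4 * q) = s + 8 * q by omega] at e2
    grind

/-! ### Extremal unitary colorings -/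

/-- A rainbow-free coloring of `{1, …, n}` with exactly the colors `0, …, r - 1`, in which the
color `0` is used once. -/
structure IsUnitaryRainbowFree (n r : ℕ) (f : ℕ → ℕ) : Prop where
  free : RainbowFree n f
  lt : ∀ x, 0 < x → x ≤ n → f x < r
  surj : ∀ i < r, ∃ x, 0 < x ∧ x ≤ n ∧ f x = i
  unique : ∀ x y, 0 < x → x ≤ n → 0 < y → y ≤ n → f x = 0 → f y = 0 → x = y

/-- A coloring of `{1, …, n}` placed on one residue class modulo `3`, all other integers getting
one new color. -/
theorem IsUnitaryRainbowFree.lift {n r : ℕ} {f : ℕ → ℕ} (hf : IsUnitaryRainbowFree n r f)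
    {t N : ℕ} (ht : t < 3) (h1 : 3 * n ≤ N + t) (h2 : N + t < 3 * (n + 1)) (hN : 2 ≤ N)
    (hr : 0 < r) :
    IsUnitaryRainbowFree N (r + 1) (fun x => if 3 ∣ x + t then f ((x + t) / 3) else r) := by
  constructor
  · intro a d ha hd had
    simp only
    -- Two terms in a residue class modulo 3 bring the third with them, so either all three terms
    -- are colored by `f` or at least two have the new color.
    split_ifs with e1 e2 e3 e3 e2 e3 e3
    · have := hf.free ((a + t) / 3) (d / 3) (by omega) (by omega) (by omega)
      rwa [show (a + t) / 3 + d / 3 = (a + d + t) / 3 by omega,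
        show (a + t) / 3 + 2 * (d / 3) = (a + 2 * d + t) / 3 by omega] at this
    all_goals omega
  · intro x hx hxN
    split_ifs with e
    · exact (hf.lt _ (by omega) (by omega)).trans (Nat.lt_succ_self _)
    · exact Nat.lt_succ_self _
  · intro i hi
    rcases (Nat.lt_succ_iff_lt_or_eq.1 hi) with h | rfl
    · obtain ⟨x, hx, hxn, rfl⟩ := hf.surj i h
      refine ⟨3 * x - t, by omega, by omega, ?_⟩
      rw [show 3 * x - t + t = 3 * x by omega]
      simp
    · by_cases e : 3 ∣ 1 + t
      · exact ⟨2, by omega, hN, if_neg (by omega)⟩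
      · exact ⟨1, by omega, by omega, if_neg e⟩
  · intro x y hx hxN hy hyN
    split_ifs with e1 e2 e2
    · intro hfx hfy
      have := hf.unique _ _ (by omega) (by omega) (by omega) (by omega) hfx hfy
      omega
    all_goals omega

/-- Merging the top colors creates no rainbow, and for s ≥ 2 color 0 is not merged. This rules out
every smaller candidate for the minimum. -/
theorem IsUnitaryRainbowFree.mono {n r s : ℕ} {f : ℕ → ℕ} (hf : IsUnitaryRainbowFree n r f)
    (hs : 2 ≤ s) (hsr : s ≤ r) : IsUnitaryRainbowFree n s (fun x => min (f x) (s - 1)) := by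
  constructor
  · intro a d ha hd had
    rcases hf.free a d ha hd had with h | h | h <;> simp [h]
  · intro x _ _
    omega
  · intro i hi
    obtain ⟨x, hx, hxn, rfl⟩ := hf.surj i (by omega)
    exact ⟨x, hx, hxn, min_eq_left (by omega)⟩
  · intro x y hx hxn hy hyn h1 h2
    exact hf.unique x y hx hxn hy hyn (by omega) (by omega)

theorem isUnitaryRainbowFree_one : IsUnitaryRainbowFree 1 1 (fun _ => 0) :=
  ⟨fun _ _ _ _ _ => Or.inl rfl, fun _ _ _ => one_pos, fun i hi => ⟨1, by omega, le_rfl, by omega⟩,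
    fun x y => by omega⟩

/-- The exceptional interval of length 7: between unique endpoints, x is colored by whether x - 1 is
a quadratic residue modulo 7. -/
theorem isUnitaryRainbowFree_eight : IsUnitaryRainbowFree 8 4
    (fun x => if x = 1 then 0 else if x = 8 then 1 else if x = 2 ∨ x = 3 ∨ x = 5 then 2 else 3) := by
  constructor
  · intro a d ha hd had
    have : a ≤ 6 := by omega
    have : d ≤ 3 := by omega
    interval_cases a <;> interval_cases d <;> simp at had ⊢
  · intro x _ _
    split_ifs <;> norm_num
  · intro i hi
    interval_cases i
    exacts [⟨1, by simp⟩, ⟨8, by simp⟩, ⟨2, by simp⟩, ⟨4, by simp⟩]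
  · intro x y _ _ _ _
    split_ifs <;> simp <;> omega

theorem exists_isUnitaryRainbowFree_pow (m : ℕ) : ∃ f, IsUnitaryRainbowFree (3 ^ m) (m + 1) f := by
  induction m with
  | zero => exact ⟨_, isUnitaryRainbowFree_one⟩
  | succ m ih =>
    obtain ⟨f, hf⟩ := ih
    have : 0 < 3 ^ m := by positivity
    exact ⟨_, hf.lift (t := 0) (by norm_num) (by rw [pow_succ]; omega) (by rw [pow_succ]; omega)
      (by rw [pow_succ]; omega) (by omega)⟩

theorem exists_isUnitaryRainbowFree {n m : ℕ} (hn : n ≠ 3 ^ m) (h1 : 7 * 3 ^ m + 9 ≤ 9 * n)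
    (h2 : 9 * n ≤ 21 * 3 ^ m) : ∃ f, IsUnitaryRainbowFree n (m + 2) f := by
  induction m generalizing n with
  | zero =>
    obtain rfl : n = 2 := by omega
    exact ⟨_, isUnitaryRainbowFree_one.lift (t := 2) (by norm_num) (by omega) (by omega) le_rfl
      one_pos⟩
  | succ m ih =>
    -- The one value that lifting cannot reach: ⌈8/3⌉ = 3 is an excluded power and ⌊8/3⌋ = 2 is
    -- below the range.
    by_cases h8 : n = 8 ∧ m = 1
    · obtain ⟨rfl, rfl⟩ := h8
      exact ⟨_, isUnitaryRainbowFree_eight⟩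
    -- Lift from k = ⌈n/3⌉ with t = 3k - n. If that k is not admissible, take k = ⌊n/3⌋ with t = 0:
    -- this occurs for n = 7 and when ⌈n/3⌉ is the excluded power of 3.
    obtain ⟨k, t, hk, ht, hk1, hk2⟩ : ∃ k t, (∃ f, IsUnitaryRainbowFree k (m + 2) f) ∧ t < 3 ∧
        3 * k ≤ n + t ∧ n + t < 3 * (k + 1) := by
      rw [pow_succ] at hn h1 h2
      rcases m with _ | _ | m
      · rcases (show n ≤ 6 ∨ n = 7 by omega) with h | h
        · exact ⟨2, 6 - n, ih (by norm_num) (by norm_num) (by norm_num), by omega, by omega,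
            by omega⟩
        · exact ⟨2, 0, ih (by norm_num) (by norm_num) (by norm_num), by omega, by omega,
            by omega⟩
      · refine ⟨(n + 2) / 3, 3 * ((n + 2) / 3) - n, ih ?_ ?_ ?_, ?_, ?_, ?_⟩ <;> omega
      · simp only [pow_succ] at hn h1 h2 ih
        by_cases hceil : (n + 2) / 3 = 3 ^ m * 3 * 3
        · exact ⟨n / 3, 0, ih (by omega) (by omega) (by omega), by omega, by omega, by omega⟩
        · refine ⟨(n + 2) / 3, 3 * ((n + 2) / 3) - n, ih hceil ?_ ?_, ?_, ?_, ?_⟩ <;> omega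
    obtain ⟨f, hf⟩ := hk
    have : 0 < 3 ^ (m + 1) := by positivity
    exact ⟨_, hf.lift ht hk1 hk2 (by omega) (by omega)⟩

/-! ### Values of the anti-van der Waerden numbers -/

namespace Coloring

/-- The numerical values of the colors, extended by `0` outside `{1, …, n}`. -/
def extend {n r : ℕ} (c : Coloring n r) (x : ℕ) : ℕ :=
  if h : x ∈ Set.Icc 1 n then c ⟨x, h⟩ else 0

theorem rainbowFree_extend {n r : ℕ} {c : Coloring n r} (hc : ¬ c.HasRainbowAP 3) :
    RainbowFree n c.extend := by
  intro a d ha hd had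
  by_contra! hcon
  have hmem : ∀ i : Fin 3, a + (i : ℕ) * d ∈ Set.Icc 1 n := fun i => by
    have : (i : ℕ) * d ≤ 2 * d := Nat.mul_le_mul_right d (by omega)
    exact ⟨by omega, by omega⟩
  refine hc ⟨a, d, fun i => ⟨_, hmem i⟩, hd, fun i => rfl, fun i j hij heq => ?_⟩
  have hext : c.extend (a + i * d) = c.extend (a + j * d) := by
    rw [extend, extend, dif_pos (hmem i), dif_pos (hmem j), heq]
  obtain ⟨h1, h2, h3⟩ := hcon
  fin_cases i <;> fin_cases j <;> simp at hij hext <;> tauto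

theorem surj_extend {n r : ℕ} {c : Coloring n r} (hc : c.IsExact) :
    ∀ i < r, ∃ x, 0 < x ∧ x ≤ n ∧ c.extend x = i := by
  intro i hi
  obtain ⟨⟨x, hx⟩, h⟩ := hc ⟨i, hi⟩
  exact ⟨x, hx.1, hx.2, by rw [extend, dif_pos hx, h]⟩

end Coloring

theorem IsUnitaryRainbowFree.exists_coloring {n r : ℕ} {f : ℕ → ℕ}
    (hf : IsUnitaryRainbowFree n r f) (hr : 0 < r) :
    ∃ c : Coloring n r, c.IsExact ∧ c.IsUnitary ∧ ¬ c.HasRainbowAP 3 := by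
  refine ⟨fun x => ⟨f x, hf.lt x x.2.1 x.2.2⟩, ?_, ?_, ?_⟩
  · intro i
    obtain ⟨x, hx, hxn, h⟩ := hf.surj i i.2
    exact ⟨⟨x, hx, hxn⟩, Fin.ext h⟩
  · obtain ⟨x, hx, hxn, h⟩ := hf.surj 0 hr
    refine ⟨⟨x, hx, hxn⟩, fun y hy => Subtype.ext ?_⟩
    have hy' : f y = f x := congrArg Fin.val hy
    exact hf.unique _ _ y.2.1 y.2.2 hx hxn (hy'.trans h) h
  · rintro ⟨a, d, t, hd, ht, hne⟩
    have h0 : (t 0 : ℕ) = a := by simpa using ht 0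
    have h1 : (t 1 : ℕ) = a + d := by simpa using ht 1
    have h2 : (t 2 : ℕ) = a + 2 * d := by simpa using ht 2
    have e01 := hne 0 1 (by decide)
    have e12 := hne 1 2 (by decide)
    have e02 := hne 0 2 (by decide)
    simp only [ne_eq, Fin.mk.injEq, h0, h1, h2] at e01 e12 e02
    have := hf.free a d (by rw [← h0]; exact (t 0).2.1) hd (by rw [← h2]; exact (t 2).2.2)
    tauto

theorem aw_eq_of_extremal {n r : ℕ} {f : ℕ → ℕ} (hn : 1 ≤ n) (hr : 2 ≤ r)
    (hf : IsUnitaryRainbowFree n r f)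
    (hup : ∀ f, RainbowFree n f → ¬ ∀ i < r + 1, ∃ x, 0 < x ∧ x ≤ n ∧ f x = i) :
    aw n 3 = r + 1 ∧ awUnitary n 3 = r + 1 := by
  have hR : ∀ c : Coloring n (r + 1), c.IsExact → c.HasRainbowAP 3 := fun c hc => by
    by_contra hcon
    exact hup _ (Coloring.rainbowFree_extend hcon) (Coloring.surj_extend hc)
  have hlow : ∀ s, 2 ≤ s → s ≤ r → ∃ c : Coloring n s, c.IsExact ∧ c.IsUnitary ∧
      ¬ c.HasRainbowAP 3 := fun s hs hsr => (hf.mono hs hsr).exists_coloring (by omega)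
  constructor
  · refine IsLeast.csInf_eq ⟨⟨by omega, hR⟩, ?_⟩
    rintro s ⟨hs, hall⟩
    by_contra! hlt
    -- A single color is not covered by the unitary colorings; the constant coloring handles it.
    rcases hs.eq_or_lt with rfl | hs
    · obtain ⟨a, d, t, -, -, hne⟩ := hall (fun _ => 0) fun i =>
        ⟨⟨1, le_rfl, hn⟩, Subsingleton.elim _ _⟩
      exact hne 0 1 (by decide) rfl
    · obtain ⟨c, hc, -, hc'⟩ := hlow s hs (by omega)
      exact hc' (hall c hc)
  · refine IsLeast.csInf_eq ⟨⟨by omega, fun c hc _ => hR c hc⟩, ?_⟩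
    rintro s ⟨hs, hall⟩
    by_contra! hlt
    obtain ⟨c, hc, hu, hc'⟩ := hlow s hs (by omega)
    exact hc' (hall c hc hu)

theorem aw_three_pow {m : ℕ} (hm : 1 ≤ m) :
    aw (3 ^ m) 3 = m + 2 ∧ awUnitary (3 ^ m) 3 = m + 2 := by
  obtain ⟨f, hf⟩ := exists_isUnitaryRainbowFree_pow m
  exact aw_eq_of_extremal (Nat.one_le_pow _ _ (by norm_num)) (by omega) hf
    fun f hf => hf.not_surj_pow

theorem aw_three_of_ne_pow {n m : ℕ} (hn : n ≠ 3 ^ m) (h1 : 7 * 3 ^ m + 9 ≤ 9 * n)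
    (h2 : 9 * n ≤ 21 * 3 ^ m) : aw n 3 = m + 3 ∧ awUnitary n 3 = m + 3 := by
  obtain ⟨f, hf⟩ := exists_isUnitaryRainbowFree hn h1 h2
  exact aw_eq_of_extremal (by omega) (by omega) hf fun f hf => hf.not_surj_of_le h2

/-- For the least m with 9n ≤ 21·3^m, minimality gives 7·3^m < 9n. For m ≥ 2 both sides are
multiples of 9, so the gap is at least 9. For m = 1 only n = 3 is missed, a power. -/
theorem exists_pow_or_range {n : ℕ} (hn : 2 ≤ n) :
    (∃ m, n = 3 ^ m) ∨ ∃ m, 7 * 3 ^ m + 9 ≤ 9 * n ∧ 9 * n ≤ 21 * 3 ^ m := by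
  have hex : ∃ m, 9 * n ≤ 21 * 3 ^ m := ⟨n, by
    have : n < 3 ^ n := Nat.lt_pow_self (by norm_num)
    omega⟩
  obtain ⟨m, hm, hmin⟩ : ∃ m, 9 * n ≤ 21 * 3 ^ m ∧ ∀ k < m, ¬ 9 * n ≤ 21 * 3 ^ k :=
    ⟨Nat.find hex, Nat.find_spec hex, fun k hk => Nat.find_min hex hk⟩
  rcases m with _ | _ | m
  · exact Or.inr ⟨0, by omega, hm⟩
  · have := hmin 0 (by norm_num)
    rcases (show n = 3 ∨ 4 ≤ n by omega) with rfl | h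
    · exact Or.inl ⟨1, rfl⟩
    · exact Or.inr ⟨1, by omega, hm⟩
  · have := hmin (m + 1) (by omega)
    refine Or.inr ⟨m + 2, ?_, hm⟩
    rw [pow_succ] at this
    rw [pow_add]
    omega

/-- Multiplying by 9 clears the negative powers of 3 that occur for m < 2. -/
theorem range_iff_nat (n m : ℕ) :
    (7 * (3 : ℝ) ^ ((m : ℤ) - 2) + 1 ≤ (n : ℝ) ∧ (n : ℝ) ≤ 21 * (3 : ℝ) ^ ((m : ℤ) - 2)) ↔
      7 * 3 ^ m + 9 ≤ 9 * n ∧ 9 * n ≤ 21 * 3 ^ m := by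
  have h : (3 : ℝ) ^ ((m : ℤ) - 2) = ((3 ^ m : ℕ) : ℝ) / 9 := by
    rw [zpow_sub₀ (by norm_num), zpow_natCast]
    norm_num
  rw [h, ← Nat.cast_le (α := ℝ), ← Nat.cast_le (α := ℝ) (m := 9 * n)]
  push_cast
  constructor <;> rintro ⟨h1, h2⟩ <;> constructor <;> linarith

/-- In both cases 3^m ≤ 3n, so m is at most log₃ n + 1, and the value is at most m + 3; hence the
constant 4. -/
theorem aw_three_le_ceil_logb {n : ℕ} (hn : 3 ≤ n) :
    (aw n 3 : ℤ) ≤ ⌈Real.logb 3 (n : ℝ)⌉ + 4 := by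
  have hn0 : (0 : ℝ) < n := by positivity
  obtain ⟨m, hm, hmn⟩ : ∃ m : ℕ, aw n 3 ≤ m + 3 ∧ 3 ^ m ≤ 3 * n := by
    by_cases hpow : ∃ m, n = 3 ^ m
    · obtain ⟨m, rfl⟩ := hpow
      have hm : 1 ≤ m := by
        by_contra! h
        interval_cases m
        simp at hn
      exact ⟨m, by rw [(aw_three_pow hm).1]; omega, by omega⟩
    · obtain ⟨m, h1, h2⟩ := (exists_pow_or_range (by omega)).resolve_left hpow
      exact ⟨m, (aw_three_of_ne_pow (fun e => hpow ⟨m, e⟩) h1 h2).1.le, by omega⟩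
  have h1 : ((m : ℝ) - 1) ≤ Real.logb 3 n := by
    rw [Real.le_logb_iff_rpow_le (by norm_num) hn0, Real.rpow_sub (by norm_num), Real.rpow_one,
      Real.rpow_natCast, div_le_iff₀ (by norm_num), mul_comm]
    exact_mod_cast hmn
  have h2 : (m : ℤ) - 1 ≤ ⌈Real.logb 3 (n : ℝ)⌉ := by
    have := h1.trans (Int.le_ceil _)
    exact_mod_cast this
  omega

theorem theorem1 :
    (∀ n : ℕ, 2 ≤ n →
      awUnitary n 3 = aw n 3 ∧
      (∀ m : ℕ, n = 3 ^ m → aw n 3 = m + 2) ∧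
      (∀ m : ℕ, n ≠ 3 ^ m →
        7 * (3 : ℝ) ^ ((m : ℤ) - 2) + 1 ≤ (n : ℝ) → (n : ℝ) ≤ 21 * (3 : ℝ) ^ ((m : ℤ) - 2) →
        aw n 3 = m + 3) ∧
      ((∃ m : ℕ, n = 3 ^ m) ∨
        ∃ m : ℕ, 7 * (3 : ℝ) ^ ((m : ℤ) - 2) + 1 ≤ (n : ℝ) ∧
          (n : ℝ) ≤ 21 * (3 : ℝ) ^ ((m : ℤ) - 2))) ∧
    ∃ C : ℤ, ∀ n : ℕ, 3 ≤ n → (aw n 3 : ℤ) ≤ ⌈Real.logb 3 (n : ℝ)⌉ + C := by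
  refine ⟨fun n hn => ?_, 4, fun n hn => aw_three_le_ceil_logb hn⟩
  have hpos : ∀ m, n = 3 ^ m → 1 ≤ m := by
    rintro m rfl
    by_contra! h
    interval_cases m
    simp at hn
  simp only [range_iff_nat]
  refine ⟨?_, ?_, ?_, exists_pow_or_range hn⟩
  · by_cases hpow : ∃ m, n = 3 ^ m
    · obtain ⟨m, hm⟩ := hpow
      obtain ⟨h1, h2⟩ := aw_three_pow (hpos m hm)
      rw [hm, h1, h2]
    · obtain ⟨m, h1, h2⟩ := (exists_pow_or_range hn).resolve_left hpow
      obtain ⟨h3, h4⟩ := aw_three_of_ne_pow (fun e => hpow ⟨m, e⟩) h1 h2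
      rw [h3, h4]
  · intro m hm
    have := (aw_three_pow (hpos m hm)).1
    rwa [← hm] at this
  · intro m hm h1 h2
    obtain ⟨h3, h4⟩ := (range_iff_nat n m).1 ⟨h1, h2⟩
    exact (aw_three_of_ne_pow hm h3 h4).1
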